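/- Let $\mathbb K\in\{\mathbb R,\mathbb C\}$. All spaces are over $\mathbb K$; "lcHs" means locally convex Hausdorff space, $Y'$ is the space of continuous linear functionals on $Y$, and $Y_b'$ is $Y'$ with the topology of uniform convergence on bounded subsets of $Y$. An lcHs is \emph{bornological} if every absolutely convex set absorbing all bounded sets is a $0$-neighbourhood; \emph{completely normable} if its topology is induced by a complete norm; \emph{semi-reflexive} if the evaluation map $Y\to (Y_b')'$ is surjective; \emph{semi-Montel} if every bounded set is relatively compact. A \emph{Banach predual} of an lcHs $(X,\tau)$ is a pair $(Y,\varphi)$ of a completely normable lcHs $Y$ and a topological isomorphism $\varphi\colon (X,\tau)\to Y_b'$; a \emph{prebidual} is a pair $(Y,\varphi)$ of an lcHs $Y$ and a topological isomorphism $\varphi\colon(X,\tau)\to(Y_b')_b'$. For a locally convex Hausdorff topology $\widetilde\tau$ on $X$ we say that $(X,\tau)$ satisfies - (BBC) for $\widetilde\tau$ if every $\tau$-bounded set is contained in an absolutely convex $\tau$-bounded $\widetilde\tau$-compact set; - (BBCl) for $\widetilde\tau$ if every $\tau$-bounded set is contained in an absolutely convex $\tau$-bounded $\widetilde\tau$-closed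 set; - (CNC) for $\widetilde\tau$ if $\tau$ has a $0$-neighbourhood basis of absolutely convex $\widetilde\tau$-closed sets. If $(X,\tau)$ is bornological, $\widetilde\tau$ is coarser than $\tau$ (written $\widetilde\tau\le\tau$), (BBCl) holds for $\widetilde\tau$ and the family of $\tau$-bounded sets has a countable basis, then that family has a countable basis $(B_n)_{n\in\mathbb N}$ of nonempty absolutely convex $\widetilde\tau$-closed sets with $2B_n\subset B_{n+1}$ for all $n$; the \emph{mixed topology} $\gamma=\gamma(\tau,\widetilde\tau)$ is the locally convex Hausdorff topology on $X$ whose $0$-neighbourhood basis is given by the sets $\bigcup_{n}\sum_{k\le n}(U_k\cap B_k)$, where $(U_k)$ runs through the sequences of absolutely convex $\widetilde\tau$-neighbourhoods of $0$ (it does not depend on the choice of $(B_n)$). \textbf{Corollary.} Let $(X,\tau)$ be a bornological locally convex Hausdorff space. The following assertions are equivalent. (a) $(X,\tau)$ has a Banach predual. (b) $(X,\tau)$ has a semi-Montel prebidual $(Y,\varphi)$ such that $Y_b'$ is completely normable. (c) $(X,\tau)$ is completely normable, and there is a locally convex Hausdorff topology $\widetilde\tau$ on $X$ such that $(X,\tau)$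 satisfies (BBC) and (CNC) for $\widetilde\tau$ and a subset of $X$ is $\tau$-bounded if and only if it is $\gamma(\tau,\widetilde\tau)$-bounded. (d) $(X,\tau)$ is completely normable, and there is a locally convex Hausdorff topology $\widetilde\tau\le\tau$ on $X$ such that $(X,\tau)$ satisfies (BBCl) for $\widetilde\tau$ and $(X,\gamma(\tau,\widetilde\tau))$ is semi-reflexive. (e) $(X,\tau)$ is completely normable and satisfies (BBC) for some locally convex Hausdorff topology $\widetilde\tau$ on $X$. (f) There are a norm $|||\cdot|||$ on $X$ which induces $\tau$ and a locally convex Hausdorff topology $\widetilde\tau$ on $X$ such that the closed unit ball $\{x\in X : |||x|||\le 1\}$ is $\widetilde\tau$-compact. (In (c) the mixed topology is defined, since (BBC) for $\widetilde\tau$ implies (BBCl) for $\widetilde\tau$ and, as $(X,\tau)$ is bornological, $\widetilde\tau\le\tau$.) -/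

import Mathlib

open Bornology Filter Topology
open scoped Pointwise ComplexOrder

universe u

section Definitions

variable (𝕜 : Type) [RCLike 𝕜] {E : Type u} [AddCommGroup E] [Module 𝕜 E]

/-- `(E, τ)` is a locally convex Hausdorff space over `𝕜`. -/
structure IsLCHausdorff (τ : TopologicalSpace E) : Prop where
  t2 : T2Space E
  topologicalAddGroup : IsTopologicalAddGroup E
  continuousSMul : ContinuousSMul 𝕜 E
  locallyConvex : LocallyConvexSpace 𝕜 E

/-- `S` is (von Neumann) bounded in `(E, τ)`. -/
def IsBddFor (τ : TopologicalSpace E) (S : Set E) : Prop :=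
  IsVonNBounded 𝕜 S

/-- `(E, τ)` is bornological: every absolutely convex set that absorbs all bounded sets is a
neighbourhood of zero. -/
def IsBornological (τ : TopologicalSpace E) : Prop :=
  ∀ U : Set E, AbsConvex 𝕜 U → (∀ S : Set E, IsBddFor 𝕜 τ S → Absorbs 𝕜 U S) → U ∈ 𝓝 (0 : E)

/-- The (semi)norm `p` is a norm and the topology it induces on `E` is `τ`. -/
structure IsNormInducing (p : Seminorm 𝕜 E) (τ : TopologicalSpace E) : Prop where
  definite : ∀ x : E, p x = 0 → x = 0
  induces : WithSeminorms (fun _ : Fin 1 => p)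

/-- `(E, τ)` is completely normable: `τ` is induced by some complete norm on `E`. -/
def IsCompletelyNormable (τ : TopologicalSpace E) : Prop :=
  ∃ p : Seminorm 𝕜 E, IsNormInducing 𝕜 p τ ∧
    @CompleteSpace E p.toAddGroupSeminorm.toSeminormedAddCommGroup.toUniformSpace

/-- `(E, τ)` is semi-reflexive: the evaluation map from `E` to the dual of its strong dual is
surjective. (`StrongDual 𝕜 E` carries the topology of uniform convergence on bounded sets.) -/
def IsSemiReflexive (τ : TopologicalSpace E) : Prop :=
  ∀ f : StrongDual 𝕜 (StrongDual 𝕜 E), ∃ x : E, ∀ g : StrongDual 𝕜 E, f g = g x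

/-- `(E, τ)` is semi-Montel: every bounded set is relatively compact. -/
def IsSemiMontel (τ : TopologicalSpace E) : Prop :=
  ∀ S : Set E, IsBddFor 𝕜 τ S → IsCompact (closure S)

/-- `(E, τ)` has a Banach predual: a completely normable locally convex Hausdorff space `Y`
together with a topological isomorphism from `(E, τ)` onto the strong dual of `Y`. -/
def HasBanachPredual (τ : TopologicalSpace E) : Prop :=
  ∃ (Y : Type u) (_ : AddCommGroup Y) (_ : Module 𝕜 Y) (σ : TopologicalSpace Y),
    IsLCHausdorff 𝕜 σ ∧ IsCompletelyNormable 𝕜 σ ∧ Nonempty (E ≃L[𝕜] StrongDual 𝕜 Y)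

/-- `(E, τ)` has a semi-Montel prebidual with completely normable strong dual: a semi-Montel
locally convex Hausdorff space `Y` with completely normable strong dual, together with a
topological isomorphism from `(E, τ)` onto the strong dual of the strong dual of `Y`. -/
def HasSemiMontelPrebidualWithCompletelyNormableDual (τ : TopologicalSpace E) : Prop :=
  ∃ (Y : Type u) (_ : AddCommGroup Y) (_ : Module 𝕜 Y) (σ : TopologicalSpace Y),
    IsLCHausdorff 𝕜 σ ∧ IsSemiMontel 𝕜 σ ∧
      IsCompletelyNormable 𝕜 (inferInstance : TopologicalSpace (StrongDual 𝕜 Y)) ∧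
      Nonempty (E ≃L[𝕜] StrongDual 𝕜 (StrongDual 𝕜 Y))

/-- Condition (BBC) of `(E, τ)` for `τ'`: every `τ`-bounded set is contained in an absolutely
convex `τ`-bounded `τ'`-compact set. -/
def SatisfiesBBC (τ τ' : TopologicalSpace E) : Prop :=
  ∀ S : Set E, IsBddFor 𝕜 τ S →
    ∃ K : Set E, S ⊆ K ∧ AbsConvex 𝕜 K ∧ IsBddFor 𝕜 τ K ∧ @IsCompact E τ' K

/-- Condition (BBCl) of `(E, τ)` for `τ'`: every `τ`-bounded set is contained in an absolutely
convex `τ`-bounded `τ'`-closed set. -/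
def SatisfiesBBCl (τ τ' : TopologicalSpace E) : Prop :=
  ∀ S : Set E, IsBddFor 𝕜 τ S →
    ∃ K : Set E, S ⊆ K ∧ AbsConvex 𝕜 K ∧ IsBddFor 𝕜 τ K ∧ @IsClosed E τ' K

/-- Condition (CNC) of `(E, τ)` for `τ'`: `τ` has a neighbourhood basis of zero consisting of
absolutely convex `τ'`-closed sets. -/
def SatisfiesCNC (τ τ' : TopologicalSpace E) : Prop :=
  ∀ V ∈ @nhds E τ 0, ∃ U ∈ @nhds E τ 0, U ⊆ V ∧ AbsConvex 𝕜 U ∧ @IsClosed E τ' U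

/-- `B` is a countable basis of the family of `τ`-bounded sets which consists of (nonempty)
absolutely convex `τ'`-closed sets with `2 • B n ⊆ B (n + 1)`. -/
structure IsMixedBasis (τ τ' : TopologicalSpace E) (B : ℕ → Set E) : Prop where
  nonempty : ∀ n, (B n).Nonempty
  absConvex : ∀ n, AbsConvex 𝕜 (B n)
  bounded : ∀ n, IsBddFor 𝕜 τ (B n)
  closed : ∀ n, @IsClosed E τ' (B n)
  double_subset : ∀ n, (2 : 𝕜) • B n ⊆ B (n + 1)
  basis : ∀ S : Set E, IsBddFor 𝕜 τ S → ∃ n, S ⊆ B n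

/-- The set `⋃ₙ ∑_{k ≤ n} (U k ∩ B k)`, with Minkowski sums. -/
def mixedSet (U B : ℕ → Set E) : Set E :=
  ⋃ n : ℕ, ∑ k ∈ Finset.range (n + 1), (U k ∩ B k)

/-- `U` is a sequence of absolutely convex neighbourhoods of zero for `τ'`. -/
def IsDiskNhdSeq (τ' : TopologicalSpace E) (U : ℕ → Set E) : Prop :=
  ∀ n, AbsConvex 𝕜 (U n) ∧ U n ∈ @nhds E τ' 0

theorem mixedSet_mono {F : Type u} [AddCommGroup F] {U V B : ℕ → Set F} (h : ∀ n, U n ⊆ V n) : mixedSet U B ⊆ mixedSet V B := by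
  refine Set.iUnion_mono fun n => ?_
  exact Set.finsetSum_subset_finsetSum _ _ _ fun k _ => Set.inter_subset_inter_left _ (h k)

/-- The mixed topology `γ(τ, τ')`: the translation invariant topology whose neighbourhoods of zero
are generated by the sets `⋃ₙ ∑_{k ≤ n} (U k ∩ B k)`, where `U` runs through the sequences of
absolutely convex `τ'`-neighbourhoods of zero and `B` is a basis of the `τ`-bounded sets as in
`IsMixedBasis`. The neighbourhoods do not depend on the choice of `B`, and `B` exists when `τ'` is
coarser than `τ`, the `τ`-bounded sets have a countable basis and (BBCl) holds for `τ'`; the mixed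
topology is used in this case only. -/
def mixedTopology (τ τ' : TopologicalSpace E) : TopologicalSpace E where
  IsOpen O := ∀ x ∈ O, ∀ B : ℕ → Set E, IsMixedBasis 𝕜 τ τ' B →
    ∃ U : ℕ → Set E, IsDiskNhdSeq 𝕜 τ' U ∧ ∀ y ∈ mixedSet U B, x + y ∈ O
  isOpen_univ := fun _ _ _ _ =>
    ⟨fun _ => Set.univ, fun _ => ⟨AbsConvex.univ, @Filter.univ_mem _ (@nhds E τ' 0)⟩,
      fun _ _ => Set.mem_univ _⟩
  isOpen_inter := by
    intro O₁ O₂ h₁ h₂ x hx B hB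
    obtain ⟨U₁, hU₁, hO₁⟩ := h₁ x hx.1 B hB
    obtain ⟨U₂, hU₂, hO₂⟩ := h₂ x hx.2 B hB
    exact ⟨fun n => U₁ n ∩ U₂ n,
      fun n => ⟨(hU₁ n).1.inter (hU₂ n).1, Filter.inter_mem (hU₁ n).2 (hU₂ n).2⟩,
      fun y hy => ⟨hO₁ y (mixedSet_mono (fun _ => Set.inter_subset_left) hy),
        hO₂ y (mixedSet_mono (fun _ => Set.inter_subset_right) hy)⟩⟩
  isOpen_sUnion := by
    intro s hs x hx B hB
    obtain ⟨O, hO, hxO⟩ := hx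
    obtain ⟨U, hU, hUO⟩ := hs O hO x hxO B hB
    exact ⟨U, hU, fun y hy => ⟨O, hO, hUO y hy⟩⟩

/-- Condition (BτBγ): the `τ`-bounded sets are exactly the `γ`-bounded sets. -/
def SameBoundedSets (τ γ : TopologicalSpace E) : Prop :=
  ∀ S : Set E, IsBddFor 𝕜 τ S ↔ IsBddFor 𝕜 γ S

end Definitions

/-!
For a compact unit ball `B` of a Hausdorff locally convex topology `τ'`, the predual is the space
`Y` of linear functionals whose restriction to `B` is `τ'`-continuous, normed by the supremum over
`B`. By Hahn–Banach, a functional on `Y` bounded by the supremum over an absolutely convex compact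
set is the evaluation at a point of that set (the Mackey–Arens argument), so `X` is the dual of `Y`.
The same `Y` is the dual of the mixed topology `γ`, which yields the equality of the `τ`-bounded and
`γ`-bounded sets (Banach–Steinhaus) and the semi-reflexivity of `γ`. Conversely, bounded closed sets
of a semi-reflexive space are compact for the weak topology, and a bounded absolutely convex compact
neighbourhood of zero is turned into a unit ball by its Minkowski gauge. Finally, the semi-Montel
prebidual of the dual of a Banach space `Z` is the weak-star dual of `Z`: its strong dual is `Z`.
-/

section AbsolutelyConvexSets

variable {𝕜 : Type*} [RCLike 𝕜] {E F : Type*} [AddCommGroup E] [Module 𝕜 E]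
  [AddCommGroup F] [Module 𝕜 F]

theorem absConvex_closedBall_zero (p : Seminorm 𝕜 E) (r : ℝ) : AbsConvex 𝕜 (p.closedBall 0 r) := by
  let : Module ℝ E := Module.restrictScalars ℝ 𝕜 E
  have : IsScalarTower ℝ 𝕜 E := IsScalarTower.restrictScalars ℝ 𝕜 E
  exact ⟨p.balanced_closedBall_zero r, convex_RCLike_iff_convex_real.2 (p.convex_closedBall 0 r)⟩

theorem absConvex_image {C : Set E} (hC : AbsConvex 𝕜 C) (f : E →ₗ[𝕜] F) :
    AbsConvex 𝕜 (f '' C) := by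
  refine ⟨?_, hC.2.linear_image f⟩
  rintro a ha _ ⟨_, ⟨x, hx, rfl⟩, rfl⟩
  exact ⟨a • x, hC.1.smul_mem ha hx, map_smul f a x⟩

theorem absConvex_preimage {C : Set F} (hC : AbsConvex 𝕜 C) (f : E →ₗ[𝕜] F) :
    AbsConvex 𝕜 (f ⁻¹' C) :=
  ⟨hC.1.mulActionHom_preimage f.toMulActionHom, hC.2.linear_preimage f⟩

theorem add_mem_two_smul_of_absConvex {C : Set E} (hC : AbsConvex 𝕜 C) {x y : E} (hx : x ∈ C)
    (hy : y ∈ C) : x + y ∈ (2 : 𝕜) • C := by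
  have h : (0 : 𝕜) ≤ 2⁻¹ := inv_nonneg.2 zero_le_two
  exact ⟨_, hC.2 hx hy h h (by norm_num), by simp [smul_smul]⟩

theorem sum_mem_of_mem_inv_two_pow_smul {C : Set E} (hC : AbsConvex 𝕜 C) (h0 : (0 : E) ∈ C)
    (n : ℕ) (v : ℕ → E) (hv : ∀ k < n, v k ∈ ((2⁻¹ : 𝕜) ^ (k + 1)) • C) :
    ∑ k ∈ Finset.range n, v k ∈ C := by
  induction n generalizing v with
  | zero => simpa using h0
  | succ n ih =>
    rw [Finset.sum_range_succ', ← Set.smul_mem_smul_set_iff₀ (two_ne_zero' 𝕜), smul_add]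
    refine add_mem_two_smul_of_absConvex hC ?_ ?_
    · rw [Finset.smul_sum]
      refine ih _ fun k hk => ?_
      rw [← Set.smul_mem_smul_set_iff₀ (inv_ne_zero (two_ne_zero' 𝕜)), smul_smul, smul_smul]
      rw [inv_mul_cancel₀ (two_ne_zero' 𝕜), one_smul, ← pow_succ']
      exact hv (k + 1) (Nat.succ_lt_succ hk)
    · simpa [Set.mem_inv_smul_set_iff₀] using hv 0 n.succ_pos

theorem norm_apply_ofReal_inv_smul {G : Type*} [SeminormedAddCommGroup G] [NormedSpace 𝕜 G]
    (f : E →ₗ[𝕜] G) {r : ℝ} (hr : 0 < r) (x : E) :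
    ‖f ((r⁻¹ : 𝕜) • x)‖ = r⁻¹ * ‖f x‖ := by
  rw [map_smul, norm_smul, norm_inv, RCLike.norm_ofReal, abs_of_pos hr]

end AbsolutelyConvexSets

section LocallyConvexSpaces

variable {𝕜 : Type*} [RCLike 𝕜] {E : Type*} [AddCommGroup E] [Module 𝕜 E]

theorem locallyConvexSpace_iff_real [TopologicalSpace E] [Module ℝ E]
    [IsScalarTower ℝ 𝕜 E] : LocallyConvexSpace 𝕜 E ↔ LocallyConvexSpace ℝ E := by
  simp only [locallyConvexSpace_iff, convex_RCLike_iff_convex_real (K := 𝕜)]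

theorem locallyConvexSpace_of_normedSpace (Y : Type*) [SeminormedAddCommGroup Y]
    [NormedSpace 𝕜 Y] : LocallyConvexSpace 𝕜 Y := by
  let := NormedSpace.restrictScalars ℝ 𝕜 Y
  have : IsScalarTower ℝ 𝕜 Y := IsScalarTower.restrictScalars ℝ 𝕜 Y
  exact locallyConvexSpace_iff_real.2 inferInstance

theorem exists_strongDual_separating_of_absConvex [TopologicalSpace E] [IsTopologicalAddGroup E]
    [ContinuousSMul 𝕜 E] [LocallyConvexSpace 𝕜 E] {C : Set E} (hC : AbsConvex 𝕜 C)
    (hcl : IsClosed C) (hne : C.Nonempty) {x : E} (hx : x ∉ C) :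
    ∃ g : StrongDual 𝕜 E, (∀ y ∈ C, ‖g y‖ ≤ 1) ∧ 1 < ‖g x‖ := by
  let : Module ℝ E := Module.restrictScalars ℝ 𝕜 E
  have : IsScalarTower ℝ 𝕜 E := IsScalarTower.restrictScalars ℝ 𝕜 E
  have : LocallyConvexSpace ℝ E := (locallyConvexSpace_iff_real (𝕜 := 𝕜)).1 inferInstance
  obtain ⟨f, u, hf, hu⟩ := RCLike.geometric_hahn_banach_closed_point (𝕜 := 𝕜)
    (convex_RCLike_iff_convex_real.1 hC.2) hcl hx
  have hu0 : 0 < u := by simpa using hf 0 (hC.1.zero_mem hne)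
  have norm_le : ∀ y ∈ C, ‖f y‖ ≤ u := fun y hy => by
    obtain ⟨c, hc, hcy⟩ := RCLike.exists_norm_eq_mul_self (f y)
    have := hf (c • y) (hC.1.smul_mem hc.le hy)
    rw [map_smul, smul_eq_mul, ← hcy, RCLike.ofReal_re] at this
    exact this.le
  have norm_inv_smul : ∀ y, ‖((u⁻¹ : 𝕜) • f) y‖ = u⁻¹ * ‖f y‖ := fun y => by
    rw [smul_apply, norm_smul, norm_inv, RCLike.norm_ofReal, abs_of_pos hu0]
  refine ⟨(u⁻¹ : 𝕜) • f, fun y hy => ?_, ?_⟩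
  · rw [norm_inv_smul, inv_mul_le_one₀ hu0]
    exact norm_le y hy
  · rw [norm_inv_smul, lt_inv_mul_iff₀ hu0, mul_one]
    exact hu.trans_le (RCLike.re_le_norm _)

theorem locallyConvexSpace_weakBilin {G : Type*} [AddCommGroup G] [Module 𝕜 G]
    (B : E →ₗ[𝕜] G →ₗ[𝕜] 𝕜) : LocallyConvexSpace 𝕜 (WeakBilin B) :=
  have := locallyConvexSpace_of_normedSpace (𝕜 := 𝕜) 𝕜
  .induced (LinearMap.pi fun g => B.flip g)

theorem exists_separating_of_absConvex_of_isClosed_weakBilin {G : Type*} [AddCommGroup G]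
    [Module 𝕜 G] (B : E →ₗ[𝕜] G →ₗ[𝕜] 𝕜) {C : Set (WeakBilin B)} (hC : AbsConvex 𝕜 C)
    (hcl : IsClosed C) (hne : C.Nonempty) {x : WeakBilin B} (hx : x ∉ C) :
    ∃ g, (∀ y ∈ C, ‖B y g‖ ≤ 1) ∧ 1 < ‖B x g‖ := by
  have := locallyConvexSpace_weakBilin B
  obtain ⟨l, hl, hlx⟩ := exists_strongDual_separating_of_absConvex hC hcl hne hx
  obtain ⟨g, rfl⟩ := LinearMap.dualEmbedding_surjective B l
  exact ⟨g, hl, hlx⟩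

theorem exists_mem_eq_of_norm_le_one_on_polar {G : Type*} [AddCommGroup G] [Module 𝕜 G]
    (B : E →ₗ[𝕜] G →ₗ[𝕜] 𝕜) {K : Set E} (hK : AbsConvex 𝕜 K) (hne : K.Nonempty)
    (hc : IsCompact ((fun x g => B x g) '' K)) (f : G →ₗ[𝕜] 𝕜)
    (hf : ∀ g, (∀ x ∈ K, ‖B x g‖ ≤ 1) → ‖f g‖ ≤ 1) : ∃ x ∈ K, B x = f := by
  let P : (G →ₗ[𝕜] 𝕜) →ₗ[𝕜] G →ₗ[𝕜] 𝕜 := LinearMap.id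
  have hP := WeakBilin.isEmbedding (B := P) Function.injective_id
  have : T2Space (WeakBilin P) := hP.t2Space
  let K' : Set (WeakBilin P) := B '' K
  have heval : (fun (φ : WeakBilin P) g => P φ g) '' K' = (fun x g => B x g) '' K :=
    Set.image_image ..
  have hcl : IsClosed K' := (hP.isCompact_iff.2 (heval ▸ hc)).isClosed
  by_contra hfK
  obtain ⟨g, hgK, hgf⟩ := exists_separating_of_absConvex_of_isClosed_weakBilin P
    (absConvex_image hK B) hcl (hne.image B) hfK
  exact hgf.not_ge (hf g fun x hx => hgK _ ⟨x, hx, rfl⟩)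

theorem exists_eq_of_norm_le_on_polar {G : Type*} [AddCommGroup G] [Module 𝕜 G]
    (B : E →ₗ[𝕜] G →ₗ[𝕜] 𝕜) {K : Set E} (hK : AbsConvex 𝕜 K) (hne : K.Nonempty)
    (hc : IsCompact ((fun x g => B x g) '' K)) (f : G →ₗ[𝕜] 𝕜) {C : ℝ}
    (hf : ∀ g, (∀ x ∈ K, ‖B x g‖ ≤ 1) → ‖f g‖ ≤ C) : ∃ x, B x = f := by
  have hr : 0 < max C 1 := by positivity
  obtain ⟨x, -, hx⟩ := exists_mem_eq_of_norm_le_one_on_polar B hK hne hc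
    (((max C 1 : ℝ) : 𝕜)⁻¹ • f) fun g hg => by
      rw [LinearMap.smul_apply, ← map_smul, norm_apply_ofReal_inv_smul f hr, inv_mul_le_one₀ hr]
      exact (hf g hg).trans (le_max_left C 1)
  refine ⟨((max C 1 : ℝ) : 𝕜) • x, ?_⟩
  rw [map_smul, hx, smul_inv_smul₀ (RCLike.ofReal_ne_zero.2 hr.ne')]

end LocallyConvexSpaces

section StrongDual

variable {𝕜 : Type*} [RCLike 𝕜] {E : Type*} [AddCommGroup E] [Module 𝕜 E]

theorem exists_eq_coe_of_mem_closure_image_eval {G : Type*} [AddCommGroup G] [Module 𝕜 G]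
    (B : E →ₗ[𝕜] G →ₗ[𝕜] 𝕜) {K : Set E} {F : G → 𝕜}
    (hF : F ∈ closure ((fun x g => B x g) '' K)) :
    ∃ f : G →ₗ[𝕜] 𝕜, f = F ∧ ∀ g, (∀ x ∈ K, ‖B x g‖ ≤ 1) → ‖f g‖ ≤ 1 := by
  have hlinear : (fun x g => B x g) '' K ⊆ Set.range ((↑) : (G →ₗ[𝕜] 𝕜) → G → 𝕜) := by
    rintro _ ⟨x, -, rfl⟩
    exact ⟨B x, rfl⟩
  obtain ⟨f, rfl⟩ := closure_minimal hlinear (LinearMap.isClosed_range_coe _ _ _) hF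
  refine ⟨f, rfl, fun g hg => ?_⟩
  have hpolar : (fun x g => B x g) '' K ⊆ {F : G → 𝕜 | ‖F g‖ ≤ 1} := by
    rintro _ ⟨x, hx, rfl⟩
    exact hg x hx
  exact closure_minimal hpolar (isClosed_le (continuous_apply g).norm continuous_const) hF

variable [TopologicalSpace E]

theorem continuous_strongDual_iff_exists_norm_le_on_polar {F : Type*} [SeminormedAddCommGroup F]
    [NormedSpace 𝕜 F] (f : StrongDual 𝕜 E →ₗ[𝕜] F) :
    Continuous f ↔ ∃ S : Set E, IsVonNBounded 𝕜 S ∧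
      ∃ C : ℝ, ∀ g : StrongDual 𝕜 E, (∀ x ∈ S, ‖g x‖ ≤ 1) → ‖f g‖ ≤ C := by
  have hbasis := ContinuousLinearMap.hasBasis_nhds_zero_of_basis (σ := RingHom.id 𝕜) (E := E)
    (Metric.nhds_basis_closedBall (x := (0 : 𝕜)))
  refine ⟨fun hf => ?_, fun ⟨S, hS, C, hC⟩ => ?_⟩
  · have hball : f ⁻¹' Metric.closedBall 0 1 ∈ 𝓝 0 :=
      hf.continuousAt.preimage_mem_nhds (by simpa using Metric.closedBall_mem_nhds 0 one_pos)
    obtain ⟨⟨S, ε⟩, ⟨hS, hε : 0 < ε⟩, hSf⟩ := hbasis.mem_iff.1 hball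
    refine ⟨S, hS, ε⁻¹, fun g hg => ?_⟩
    have hεg : (ε : 𝕜) • g ∈ f ⁻¹' Metric.closedBall 0 1 := hSf fun x hx => by
      simpa [norm_smul, abs_of_pos hε] using mul_le_of_le_one_right hε.le (hg x hx)
    rw [Set.mem_preimage, mem_closedBall_zero_iff, map_smul, norm_smul, RCLike.norm_ofReal,
      abs_of_pos hε] at hεg
    rwa [← one_div, le_div_iff₀' hε]
  · have hpolar : {g : StrongDual 𝕜 E | ∀ x ∈ S, g x ∈ Metric.closedBall (0 : 𝕜) 1} ∈ 𝓝 0 :=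
      hbasis.mem_of_mem (i := (S, 1)) ⟨hS, one_pos⟩
    have hbdd : IsBounded (f '' {g | ∀ x ∈ S, g x ∈ Metric.closedBall (0 : 𝕜) 1}) := by
      refine isBounded_iff_forall_norm_le.2 ⟨C, ?_⟩
      rintro _ ⟨g, hg, rfl⟩
      exact hC g fun x hx => mem_closedBall_zero_iff.1 (hg x hx)
    exact (f.clmOfExistsBoundedImage
      ⟨_, hpolar, (NormedSpace.isVonNBounded_iff 𝕜).2 hbdd⟩).continuous

theorem exists_norm_apply_le_of_isVonNBounded {S : Set E} (hS : IsVonNBounded 𝕜 S)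
    (g : StrongDual 𝕜 E) : ∃ r, ∀ x ∈ S, ‖g x‖ ≤ r := by
  obtain ⟨r, hr⟩ := isBounded_iff_forall_norm_le.1
    ((NormedSpace.isVonNBounded_iff 𝕜).1 (hS.image g))
  exact ⟨r, fun x hx => hr _ ⟨x, hx, rfl⟩⟩

end StrongDual

section SemiReflexiveSpaces

variable {𝕜 : Type} [RCLike 𝕜] {E : Type u} [AddCommGroup E] [Module 𝕜 E]
  {τ : TopologicalSpace E}

theorem isSemiReflexive_of_isCompact_image_eval
    (h : ∀ S : Set E, IsVonNBounded 𝕜 S → ∃ K, S ⊆ K ∧ AbsConvex 𝕜 K ∧ K.Nonempty ∧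
      IsCompact ((fun x (g : StrongDual 𝕜 E) => g x) '' K)) :
    IsSemiReflexive 𝕜 τ := by
  intro f
  obtain ⟨S, hS, C, hC⟩ :=
    (continuous_strongDual_iff_exists_norm_le_on_polar f.toLinearMap).1 f.cont
  obtain ⟨K, hSK, hK, hne, hc⟩ := h S hS
  obtain ⟨x, hx⟩ := exists_eq_of_norm_le_on_polar (ContinuousLinearMap.coeLM 𝕜).flip hK hne hc
    f.toLinearMap fun g hg => hC g fun x hx => hg x (hSK hx)
  exact ⟨x, fun g => (LinearMap.congr_fun hx g).symm⟩

theorem IsSemiReflexive.isCompact_image_eval (h : IsSemiReflexive 𝕜 τ) {K : Set E}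
    (hK : IsVonNBounded 𝕜 K)
    (hsep : ∀ x ∉ K, ∃ g : StrongDual 𝕜 E, (∀ y ∈ K, ‖g y‖ ≤ 1) ∧ 1 < ‖g x‖) :
    IsCompact ((fun x (g : StrongDual 𝕜 E) => g x) '' K) := by
  choose r hr using exists_norm_apply_le_of_isVonNBounded hK
  have hsub : (fun x (g : StrongDual 𝕜 E) => g x) '' K ⊆
      Set.pi Set.univ fun g => Metric.closedBall (0 : 𝕜) (r g) := by
    rintro _ ⟨x, hx, rfl⟩ g -
    simpa using hr g x hx
  refine (isCompact_univ_pi fun g => isCompact_closedBall 0 (r g)).of_isClosed_subset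
    (isClosed_of_closure_subset fun F hF => ?_) hsub
  obtain ⟨f, rfl, hf⟩ := exists_eq_coe_of_mem_closure_image_eval
    (ContinuousLinearMap.coeLM 𝕜 : StrongDual 𝕜 E →ₗ[𝕜] E →ₗ[𝕜] 𝕜).flip hF
  have hcont : Continuous f :=
    (continuous_strongDual_iff_exists_norm_le_on_polar f).2 ⟨K, hK, 1, hf⟩
  obtain ⟨x, hx⟩ := h ⟨f, hcont⟩
  have hxK : x ∈ K := by
    by_contra hxK
    obtain ⟨g, hgK, hgx⟩ := hsep x hxK
    exact hgx.not_ge (hx g ▸ hf g hgK)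
  exact ⟨x, hxK, funext fun g => (hx g).symm⟩

theorem isLCHausdorff_weakBilin {G : Type*} [AddCommGroup G] [Module 𝕜 G] {B : E →ₗ[𝕜] G →ₗ[𝕜] 𝕜}
    (hB : Function.Injective B) :
    IsLCHausdorff 𝕜 (inferInstance : TopologicalSpace (WeakBilin B)) where
  t2 := (WeakBilin.isEmbedding hB).t2Space
  topologicalAddGroup := inferInstance
  continuousSMul := inferInstance
  locallyConvex := locallyConvexSpace_weakBilin B

theorem IsSemiReflexive.exists_isLCHausdorff_isCompact [SeparatingDual 𝕜 E]
    (h : IsSemiReflexive 𝕜 τ) {K : Set E} (hK : IsBddFor 𝕜 τ K)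
    (hsep : ∀ x ∉ K, ∃ g : StrongDual 𝕜 E, (∀ y ∈ K, ‖g y‖ ≤ 1) ∧ 1 < ‖g x‖) :
    ∃ σ : TopologicalSpace E, IsLCHausdorff 𝕜 σ ∧ @IsCompact E σ K := by
  let B : E →ₗ[𝕜] StrongDual 𝕜 E →ₗ[𝕜] 𝕜 := (ContinuousLinearMap.coeLM 𝕜).flip
  have hB : Function.Injective B := (injective_iff_map_eq_zero B).2 fun x hx =>
    SeparatingDual.eq_zero_of_forall_dual_eq_zero (R := 𝕜) (LinearMap.congr_fun hx)
  exact ⟨_, isLCHausdorff_weakBilin hB,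
    (WeakBilin.isEmbedding hB).isCompact_iff.2 (h.isCompact_image_eval hK hsep)⟩

theorem IsLCHausdorff.exists_continuous_separating (h : IsLCHausdorff 𝕜 τ) {K : Set E}
    (hK : AbsConvex 𝕜 K) (hcl : IsClosed K) (hne : K.Nonempty) {x : E} (hx : x ∉ K) :
    ∃ g : E →ₗ[𝕜] 𝕜, Continuous g ∧ (∀ y ∈ K, ‖g y‖ ≤ 1) ∧ 1 < ‖g x‖ := by
  obtain ⟨_, _, _, _⟩ := h
  obtain ⟨g, hg⟩ := exists_strongDual_separating_of_absConvex hK hcl hne hx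
  exact ⟨g, g.cont, hg⟩

theorem IsLCHausdorff.exists_continuous_apply_ne_zero (h : IsLCHausdorff 𝕜 τ) {x : E}
    (hx : x ≠ 0) : ∃ g : E →ₗ[𝕜] 𝕜, Continuous g ∧ g x ≠ 0 := by
  have := h.t2
  obtain ⟨g, hg, -, hgx⟩ := h.exists_continuous_separating (K := {0})
    ⟨balanced_zero, convex_singleton 0⟩ isClosed_singleton ⟨0, rfl⟩ hx
  exact ⟨g, hg, norm_pos_iff.1 (one_pos.trans hgx)⟩

theorem exists_isLCHausdorff_isCompact_of_isSemiReflexive {γ τ' : TopologicalSpace E}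
    (hγ : IsSemiReflexive 𝕜 γ) (h : IsLCHausdorff 𝕜 τ') (hle : γ ≤ τ') {K : Set E}
    (hK : AbsConvex 𝕜 K) (hne : K.Nonempty) (hcl : IsClosed[τ'] K) (hb : IsBddFor 𝕜 γ K) :
    ∃ σ : TopologicalSpace E, IsLCHausdorff 𝕜 σ ∧ @IsCompact E σ K := by
  have hsep : ∀ x ∉ K, ∃ g : E →ₗ[𝕜] 𝕜, Continuous[γ, _] g ∧ (∀ y ∈ K, ‖g y‖ ≤ 1) ∧ 1 < ‖g x‖ :=
    fun x hx => by
      obtain ⟨g, hg, hgx⟩ := h.exists_continuous_separating hK hcl hne hx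
      exact ⟨g, continuous_le_dom hle hg, hgx⟩
  have hsep0 : ∀ x ≠ 0, ∃ g : E →ₗ[𝕜] 𝕜, Continuous[γ, _] g ∧ g x ≠ 0 := fun x hx => by
    obtain ⟨g, hg, hgx⟩ := h.exists_continuous_apply_ne_zero hx
    exact ⟨g, continuous_le_dom hle hg, hgx⟩
  -- As long as `τ'` is in the context, instance search finds it before `γ`.
  clear! τ'
  have : SeparatingDual 𝕜 E := ⟨fun x hx => by
    obtain ⟨g, hg, hgx⟩ := hsep0 x hx
    exact ⟨⟨g, hg⟩, hgx⟩⟩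
  exact hγ.exists_isLCHausdorff_isCompact hb fun x hx => by
    obtain ⟨g, hg, hgK, hgx⟩ := hsep x hx
    exact ⟨⟨g, hg⟩, hgK, hgx⟩

end SemiReflexiveSpaces

section NormableSpaces

variable {𝕜 : Type} [RCLike 𝕜] {E : Type u} [AddCommGroup E] [Module 𝕜 E] {p : Seminorm 𝕜 E}
  {τ : TopologicalSpace E}

theorem isLCHausdorff_of_normedSpace (Y : Type u) [NormedAddCommGroup Y] [NormedSpace 𝕜 Y] :
    IsLCHausdorff 𝕜 (inferInstance : TopologicalSpace Y) where
  t2 := inferInstance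
  topologicalAddGroup := inferInstance
  continuousSMul := inferInstance
  locallyConvex := locallyConvexSpace_of_normedSpace Y

/-- The structure of a normed group on `E` whose norm is `p`; its topology is definitionally equal
to `τ`. -/
abbrev IsNormInducing.normedAddCommGroup (h : IsNormInducing 𝕜 p τ) : NormedAddCommGroup E :=
  letI : Norm E := ⟨p⟩
  have core : NormedSpace.Core 𝕜 E :=
    { norm_nonneg := apply_nonneg p
      norm_smul := map_smul_eq_mul p
      norm_triangle := map_add_le_add p
      norm_eq_zero_iff := fun x => ⟨h.definite x, fun hx => hx ▸ map_zero p⟩ }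
  NormedAddCommGroup.ofCoreReplaceTopology core <| by
    let := SeminormedAddCommGroup.ofCore core.toCore
    let := NormedSpace.ofCore core
    exact h.induces.withSeminorms_eq.trans
      (WithSeminorms.withSeminorms_eq (t := _) (norm_withSeminorms 𝕜 E)).symm

/-- The structure of a normed space over `𝕜` on `E` whose norm is `p`. -/
abbrev IsNormInducing.normedSpace (h : IsNormInducing 𝕜 p τ) :
    @NormedSpace 𝕜 E _ h.normedAddCommGroup.toSeminormedAddCommGroup :=
  letI := h.normedAddCommGroup
  { norm_smul_le := fun a x => (map_smul_eq_mul p a x).le }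

theorem IsNormInducing.comp_equiv {F : Type*} [NormedAddCommGroup F] [NormedSpace 𝕜 F]
    (e : E ≃L[𝕜] F) : IsNormInducing 𝕜 ((normSeminorm 𝕜 F).comp (e : E →ₗ[𝕜] F)) τ where
  definite x hx := (map_eq_zero_iff e e.injective).1 (norm_eq_zero.1 hx)
  induces := by
    have h := LinearMap.withSeminorms_induced (norm_withSeminorms 𝕜 F) (e : E →ₗ[𝕜] F)
    rwa [show TopologicalSpace.induced (e : E →ₗ[𝕜] F) inferInstance = τ from
      e.toHomeomorph.isInducing.eq_induced.symm] at h

theorem IsCompletelyNormable.of_equiv {F : Type*} [NormedAddCommGroup F] [NormedSpace 𝕜 F]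
    [CompleteSpace F] (e : E ≃L[𝕜] F) : IsCompletelyNormable 𝕜 τ := by
  refine ⟨_, IsNormInducing.comp_equiv e, ?_⟩
  let := ((normSeminorm 𝕜 F).comp (e : E →ₗ[𝕜] F)).toAddGroupSeminorm.toSeminormedAddCommGroup
  have he : Isometry e := AddMonoidHomClass.isometry_of_norm e fun x => rfl
  exact (he.isUniformInducing.completeSpace_congr e.surjective).2 inferInstance

theorem HasBanachPredual.exists_normedSpace (h : HasBanachPredual 𝕜 τ) :
    ∃ (Y : Type u) (_ : NormedAddCommGroup Y) (_ : NormedSpace 𝕜 Y),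
      CompleteSpace Y ∧ Nonempty (E ≃L[𝕜] StrongDual 𝕜 Y) := by
  obtain ⟨Y, _, _, σ, -, ⟨p, hp, hc⟩, he⟩ := h
  refine ⟨Y, hp.normedAddCommGroup, hp.normedSpace, ?_, he⟩
  convert! hc using 1
  exact @UniformSpace.replaceTopology_eq Y σ _ _

theorem HasBanachPredual.of_equiv {Y : Type u} [NormedAddCommGroup Y] [NormedSpace 𝕜 Y]
    [CompleteSpace Y] (e : E ≃L[𝕜] StrongDual 𝕜 Y) : HasBanachPredual 𝕜 τ :=
  ⟨Y, inferInstance, inferInstance, inferInstance, isLCHausdorff_of_normedSpace Y,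
    IsCompletelyNormable.of_equiv (.refl 𝕜 Y), ⟨e⟩⟩

theorem HasBanachPredual.isCompletelyNormable (h : HasBanachPredual 𝕜 τ) :
    IsCompletelyNormable 𝕜 τ := by
  obtain ⟨Y, _, _, -, ⟨e⟩⟩ := h.exists_normedSpace
  exact .of_equiv e

theorem IsNormInducing.isBddFor_iff (h : IsNormInducing 𝕜 p τ) {S : Set E} :
    IsBddFor 𝕜 τ S ↔ ∃ r > 0, S ⊆ p.closedBall 0 r := by
  refine h.induces.isVonNBounded_iff_seminorm_bounded.trans ⟨fun hS => ?_, fun ⟨r, hr, hS⟩ _ => ?_⟩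
  · obtain ⟨r, hr, hS⟩ := hS 0
    exact ⟨r, hr, fun x hx => p.mem_closedBall_zero.2 (hS x hx).le⟩
  · exact ⟨r + 1, by positivity, fun x hx =>
      (p.mem_closedBall_zero.1 (hS hx)).trans_lt (lt_add_one r)⟩

theorem IsNormInducing.isBddFor_closedBall (h : IsNormInducing 𝕜 p τ) (r : ℝ) :
    IsBddFor 𝕜 τ (p.closedBall 0 r) :=
  h.isBddFor_iff.2 ⟨max r 1, by positivity, p.closedBall_mono (le_max_left _ _)⟩

theorem IsNormInducing.nhds_zero_hasBasis_closedBall (h : IsNormInducing 𝕜 p τ) :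
    (𝓝 (0 : E)).HasBasis (fun r : ℝ => 0 < r) fun r => p.closedBall 0 r := by
  let := h.normedAddCommGroup
  convert! Metric.nhds_basis_closedBall (x := (0 : E)) using 2 with r
  ext x
  rw [p.mem_closedBall_zero, mem_closedBall_zero_iff]
  rfl

theorem closedBall_zero_eq_smul (p : Seminorm 𝕜 E) {r : ℝ} (hr : 0 < r) :
    p.closedBall 0 r = (r : 𝕜) • p.closedBall 0 1 := by
  rw [p.smul_closedBall_zero (by simpa using hr.ne'), RCLike.norm_ofReal, abs_of_pos hr, mul_one]

end NormableSpaces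

section Predual

variable {𝕜 : Type*} [RCLike 𝕜] {D E : Type*} [TopologicalSpace D]

/-- The functionals on a topological vector space `E` that are continuous on the bounded sets for a
second topology. The space with this topology is encoded as a space `D` with a map `d : D → E`. If
the unit ball of a normed space `E` is compact for the second topology, this is the predual of
Dixmier and Ng. -/
def boundedContinuousDual (𝕜 : Type*) [RCLike 𝕜] [AddCommGroup E] [Module 𝕜 E]
    [TopologicalSpace E] (d : D → E) : Submodule 𝕜 (StrongDual 𝕜 E) where
  carrier := {g | ∀ S : Set E, IsVonNBounded 𝕜 S → ContinuousOn (fun w => g (d w)) (d ⁻¹' S)}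
  zero_mem' := fun _ _ => continuousOn_const
  add_mem' := fun hf hg S hS => (hf S hS).add (hg S hS)
  smul_mem' := fun c _ hf S hS => (hf S hS).const_smul c

theorem isClosed_boundedContinuousDual [AddCommGroup E] [Module 𝕜 E] [TopologicalSpace E]
    (d : D → E) : IsClosed (boundedContinuousDual 𝕜 d : Set (StrongDual 𝕜 E)) := by
  refine isClosed_iff_forall_filter.2 fun f l _ hl hf S hS => ?_
  have hunif := (UniformConvergenceCLM.tendsto_iff_tendstoUniformlyOn
    (RingHom.id 𝕜) 𝕜 {S : Set E | IsVonNBounded 𝕜 S}).1 hf S hS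
  have hmem : ∀ᶠ g in l, g ∈ boundedContinuousDual 𝕜 d := le_principal_iff.1 hl
  exact (hunif.comp d).continuousOn (hmem.mono fun g hg => hg S hS).frequently

theorem isCompact_image_eval_boundedContinuousDual [AddCommGroup E] [Module 𝕜 E]
    [TopologicalSpace E] {d : D → E} (hd : Function.Surjective d) {K : Set E}
    (hK : IsCompact (d ⁻¹' K)) (hb : IsVonNBounded 𝕜 K) :
    IsCompact ((fun x (g : boundedContinuousDual 𝕜 d) => (g : StrongDual 𝕜 E) x) '' K) := by
  rw [← Set.image_preimage_eq K hd, Set.image_image]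
  exact hK.image_of_continuousOn (continuousOn_pi.2 fun g => g.2 K hb)

section NormedSpaces

variable [NormedAddCommGroup E] [NormedSpace 𝕜 E] {Y : Type*} [NormedAddCommGroup Y]
  [NormedSpace 𝕜 Y] (ι : Y →ₗᵢ[𝕜] StrongDual 𝕜 E)

theorem norm_flip_apply_of_norming (hι : ∀ x, 1 < ‖x‖ → ∃ y, ‖y‖ ≤ 1 ∧ 1 < ‖ι y x‖) (x : E) :
    ‖ι.toContinuousLinearMap.flip x‖ = ‖x‖ := by
  refine le_antisymm (ContinuousLinearMap.opNorm_le_bound _ (norm_nonneg x) fun y => ?_) ?_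
  · exact ((ι y).le_opNorm x).trans_eq (by rw [ι.norm_map, mul_comm])
  · by_contra! hlt
    obtain ⟨r, hr, hrx⟩ := exists_between hlt
    have hr0 : 0 < r := (norm_nonneg _).trans_lt hr
    obtain ⟨y, hy, hyx⟩ := hι ((r⁻¹ : 𝕜) • x) <| by
      rwa [← LinearMap.id_apply (R := 𝕜) ((r⁻¹ : 𝕜) • x), norm_apply_ofReal_inv_smul _ hr0,
        LinearMap.id_apply, lt_inv_mul_iff₀ hr0, mul_one]
    have hyr : r < ‖ι y x‖ := by
      rwa [← ContinuousLinearMap.coe_coe, norm_apply_ofReal_inv_smul _ hr0, lt_inv_mul_iff₀ hr0,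
        mul_one] at hyx
    exact (hyr.trans_le ((ι.toContinuousLinearMap.flip x).unit_le_opNorm y hy)).not_gt hr

theorem surjective_flip_of_isCompact
    (hc : IsCompact ((fun x y => ι y x) '' Metric.closedBall (0 : E) 1)) :
    Function.Surjective ι.toContinuousLinearMap.flip := by
  intro f
  have hball : AbsConvex 𝕜 (Metric.closedBall (0 : E) 1) := by
    simpa only [closedBall_normSeminorm] using absConvex_closedBall_zero (normSeminorm 𝕜 E) 1
  obtain ⟨x, hx⟩ := exists_eq_of_norm_le_on_polar
    ((ContinuousLinearMap.coeLM 𝕜).comp ι.toContinuousLinearMap.flip.toLinearMap) hball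
    ⟨0, by simp⟩ hc f.toLinearMap (C := ‖f‖) fun y hy => f.unit_le_opNorm y <| by
      rw [← ι.norm_map]
      exact (ι y).opNorm_le_of_unit_norm zero_le_one fun x hx => hy x (by simp [hx])
  exact ⟨x, ContinuousLinearMap.ext (LinearMap.congr_fun hx)⟩

theorem exists_equiv_strongDual_of_isCompact
    (hι : ∀ x, 1 < ‖x‖ → ∃ y, ‖y‖ ≤ 1 ∧ 1 < ‖ι y x‖)
    (hc : IsCompact ((fun x y => ι y x) '' Metric.closedBall (0 : E) 1)) :
    ∃ e : E ≃L[𝕜] StrongDual 𝕜 Y, ∀ x y, e x y = ι y x :=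
  ⟨(LinearIsometryEquiv.ofSurjective
      ⟨ι.toContinuousLinearMap.flip.toLinearMap, norm_flip_apply_of_norming ι hι⟩
      (surjective_flip_of_isCompact ι hc)).toContinuousLinearEquiv, fun _ _ => rfl⟩

end NormedSpaces

end Predual

section DixmierNg

variable {𝕜 : Type} [RCLike 𝕜] {E : Type u}

theorem exists_predual_of_isCompact_closedBall {D : Type u} [AddCommGroup D] [Module 𝕜 D]
    {τ' : TopologicalSpace D} (h : IsLCHausdorff 𝕜 τ') [NormedAddCommGroup E] [NormedSpace 𝕜 E]
    (d : D ≃ₗ[𝕜] E) (hK : IsCompact (d ⁻¹' Metric.closedBall 0 1)) :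
    ∃ (Y : Type u) (_ : NormedAddCommGroup Y) (_ : NormedSpace 𝕜 Y) (_ : CompleteSpace Y)
      (e : E ≃L[𝕜] StrongDual 𝕜 Y),
      ∀ y S, IsVonNBounded 𝕜 S → ContinuousOn (fun w => e (d w) y) (d ⁻¹' S) := by
  let V := boundedContinuousDual 𝕜 d
  have hnorming : ∀ x, 1 < ‖x‖ → ∃ g : V, ‖g‖ ≤ 1 ∧ 1 < ‖V.subtypeₗᵢ g x‖ := by
    intro x hx
    have hball : AbsConvex 𝕜 (d ⁻¹' Metric.closedBall 0 1) :=
      absConvex_preimage (closedBall_normSeminorm 𝕜 E ▸ absConvex_closedBall_zero _ 1) d.toLinearMap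
    obtain ⟨g, hg, hgK, hgx⟩ := h.exists_continuous_separating hball
      (@IsCompact.isClosed D τ' h.t2 _ hK) ⟨0, by simp⟩ (x := d.symm x) (by simpa using hx)
    have hbound : ∀ y : E, ‖g (d.symm y)‖ ≤ 1 * ‖y‖ := by
      simpa using LinearMap.bound_of_ball_bound' one_pos 1 (g ∘ₗ d.symm.toLinearMap)
        fun y hy => hgK (d.symm y) (by simpa using hy)
    refine ⟨⟨(g ∘ₗ d.symm.toLinearMap).mkContinuous 1 hbound, fun S _ => ?_⟩,
      (g ∘ₗ d.symm.toLinearMap).mkContinuous_norm_le zero_le_one hbound, hgx⟩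
    simpa using hg.continuousOn
  let : NormedAddCommGroup V := inferInstance
  let : NormedSpace 𝕜 V := inferInstance
  refine ⟨V, ‹_›, ‹_›, (isClosed_boundedContinuousDual d).completeSpace_coe, ?_⟩
  obtain ⟨e, he⟩ := exists_equiv_strongDual_of_isCompact (Y := V) V.subtypeₗᵢ hnorming <|
    isCompact_image_eval_boundedContinuousDual d.surjective hK
      (NormedSpace.isVonNBounded_closedBall 𝕜 E 1)
  exact ⟨e, fun g S hS => (g.2 S hS).congr fun w _ => he (d w) g⟩

theorem IsNormInducing.exists_predual [AddCommGroup E] [Module 𝕜 E] {τ' τ : TopologicalSpace E}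
    {p : Seminorm 𝕜 E} (hp : IsNormInducing 𝕜 p τ) (h : IsLCHausdorff 𝕜 τ')
    (hK : @IsCompact E τ' (p.closedBall 0 1)) :
    ∃ (Y : Type u) (_ : NormedAddCommGroup Y) (_ : NormedSpace 𝕜 Y) (_ : CompleteSpace Y)
      (e : E ≃L[𝕜] StrongDual 𝕜 Y),
      ∀ y S, IsBddFor 𝕜 τ S → @ContinuousOn E 𝕜 τ' _ (fun x => e x y) S := by
  have hball : @Metric.closedBall E hp.normedAddCommGroup.toPseudoMetricSpace 0 1 =
      p.closedBall 0 1 := by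
    let := hp.normedAddCommGroup
    exact Set.ext fun x => mem_closedBall_zero_iff.trans p.mem_closedBall_zero.symm
  exact @exists_predual_of_isCompact_closedBall 𝕜 _ E E _ _ τ' h hp.normedAddCommGroup
    hp.normedSpace (.refl 𝕜 E) (hball ▸ hK)

end DixmierNg

section UniformBoundedness

variable {𝕜 : Type*} [RCLike 𝕜] {D Y : Type*} [AddCommGroup D] [Module 𝕜 D] [TopologicalSpace D]
  [NormedAddCommGroup Y] [NormedSpace 𝕜 Y] [CompleteSpace Y]

theorem isVonNBounded_image_of_continuous_apply (L : D →ₗ[𝕜] StrongDual 𝕜 Y)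
    (hL : ∀ y, Continuous fun w => L w y) {S : Set D} (hS : IsVonNBounded 𝕜 S) :
    IsVonNBounded 𝕜 (L '' S) := by
  have hpointwise : ∀ y, ∃ C, ∀ w : S, ‖L w y‖ ≤ C := fun y => by
    let ev : StrongDual 𝕜 D := ⟨(ContinuousLinearMap.coeLM 𝕜).flip y ∘ₗ L, hL y⟩
    exact (exists_norm_apply_le_of_isVonNBounded hS ev).imp fun C hC w => hC w w.2
  obtain ⟨C, hC⟩ := banach_steinhaus hpointwise
  refine (NormedSpace.isVonNBounded_iff 𝕜).2 (isBounded_iff_forall_norm_le.2 ⟨C, ?_⟩)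
  rintro _ ⟨w, hw, rfl⟩
  exact hC ⟨w, hw⟩

end UniformBoundedness

section MixedTopology

variable {𝕜 : Type} [RCLike 𝕜] {E : Type u} [AddCommGroup E] [Module 𝕜 E]
  {τ τ' : TopologicalSpace E} {U B : ℕ → Set E}

theorem inter_subset_mixedSet (h0 : ∀ k, (0 : E) ∈ U k ∩ B k) (n : ℕ) :
    U n ∩ B n ⊆ mixedSet U B := by
  refine fun x hx => Set.mem_iUnion.2 ⟨n, (Set.mem_finsetSum _ _ _).2 ⟨Pi.single n x, ?_, ?_⟩⟩
  · intro k _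
    obtain rfl | hk := eq_or_ne k n
    · rwa [Pi.single_eq_same]
    · rw [Pi.single_eq_of_ne hk]
      exact h0 k
  · rw [Finset.sum_pi_single', if_pos (Finset.self_mem_range_succ n)]

theorem mixedSet_subset_of_absConvex {W : Set E} (hW : AbsConvex 𝕜 W) (h0 : (0 : E) ∈ W)
    (h : ∀ k, U k ∩ B k ⊆ ((2⁻¹ : 𝕜) ^ (k + 1)) • W) : mixedSet U B ⊆ W := by
  intro x hx
  obtain ⟨n, hn⟩ := Set.mem_iUnion.1 hx
  obtain ⟨v, hv, rfl⟩ := (Set.mem_finsetSum _ _ _).1 hn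
  exact sum_mem_of_mem_inv_two_pow_smul hW h0 _ v fun k hk => h k (hv (Finset.mem_range.2 hk))

theorem IsMixedBasis.zero_mem (hB : IsMixedBasis 𝕜 τ τ' B) (n : ℕ) : (0 : E) ∈ B n :=
  (hB.absConvex n).1.zero_mem (hB.nonempty n)

theorem IsMixedBasis.exists_inter_subset_of_mem_nhds (hB : IsMixedBasis 𝕜 τ τ' B) {V : Set E}
    (hV : V ∈ @nhds E (mixedTopology 𝕜 τ τ') 0) (n : ℕ) : ∃ U ∈ 𝓝 (0 : E), U ∩ B n ⊆ V := by
  obtain ⟨O, hOV, hO, h0⟩ := (@mem_nhds_iff E (mixedTopology 𝕜 τ τ') 0 V).1 hV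
  obtain ⟨U, hU, hUO⟩ := hO 0 h0 B hB
  refine ⟨U n, (hU n).2, fun x hx => hOV ?_⟩
  have hzero : ∀ k, (0 : E) ∈ U k ∩ B k := fun k =>
    ⟨mem_of_mem_nhds (hU k).2, hB.zero_mem k⟩
  simpa using hUO x (inter_subset_mixedSet hzero n hx)

theorem IsMixedBasis.isBddFor_mixedTopology (hB : IsMixedBasis 𝕜 τ τ' B) (hle : τ ≤ τ') {S : Set E}
    (hS : IsBddFor 𝕜 τ S) : IsBddFor 𝕜 (mixedTopology 𝕜 τ τ') S := by
  intro V hV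
  obtain ⟨n, hn⟩ := hB.basis S hS
  obtain ⟨U, hU, hUV⟩ := hB.exists_inter_subset_of_mem_nhds hV n
  have hBS : Absorbs 𝕜 (B n) S := (hB.absConvex n).1.absorbs_self.mono_right hn
  exact ((IsVonNBounded.of_topologicalSpace_le hle hS hU).inter hBS).mono_left hUV

theorem continuous_mixedTopology_of_continuousOn_bounded (h : IsLCHausdorff 𝕜 τ') {F : Type*}
    [AddCommGroup F] [Module 𝕜 F] [TopologicalSpace F] [IsTopologicalAddGroup F]
    [ContinuousSMul 𝕜 F] [LocallyConvexSpace 𝕜 F] (f : E →ₗ[𝕜] F)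
    (hf : ∀ S, IsBddFor 𝕜 τ S → ContinuousOn f S) :
    Continuous[mixedTopology 𝕜 τ τ', _] f := by
  obtain ⟨_, _, _, _⟩ := h
  refine continuous_def.2 fun O hO x hx B hB => ?_
  have hOx : (fun z => f x + z) ⁻¹' O ∈ 𝓝 0 :=
    (continuous_const_add (f x)).continuousAt.preimage_mem_nhds (by simpa using hO.mem_nhds hx)
  obtain ⟨W, ⟨hW0, hW⟩, hWO⟩ := (nhds_hasBasis_absConvex 𝕜 F).mem_iff.1 hOx
  have htrace : ∀ k, ∃ U ∈ 𝓝 (0 : E), AbsConvex 𝕜 U ∧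
      U ∩ B k ⊆ ((2⁻¹ : 𝕜) ^ (k + 1)) • (f ⁻¹' W) := fun k => by
    have hc : ((2⁻¹ : 𝕜) ^ (k + 1)) ≠ 0 := by simp
    have hmem : f ⁻¹' (((2⁻¹ : 𝕜) ^ (k + 1)) • W) ∈ 𝓝[B k] 0 :=
      (hf _ (hB.bounded k) 0 (hB.zero_mem k)).preimage_mem_nhdsWithin <| by
        rw [map_zero]
        exact (set_smul_mem_nhds_zero_iff hc).2 hW0
    obtain ⟨V, hV, hVB⟩ := mem_nhdsWithin_iff_exists_mem_nhds_inter.1 hmem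
    obtain ⟨U, ⟨hU0, hU⟩, hUV⟩ := (nhds_hasBasis_absConvex 𝕜 E).mem_iff.1 hV
    refine ⟨U, hU0, hU, fun y hy => ?_⟩
    have hfy := hVB ⟨hUV hy.1, hy.2⟩
    rwa [Set.mem_preimage, Set.mem_smul_set_iff_inv_smul_mem₀ hc, ← map_smul,
      ← Set.mem_preimage, ← Set.mem_smul_set_iff_inv_smul_mem₀ hc] at hfy
  choose U hU0 hU hUB using htrace
  refine ⟨U, fun k => ⟨hU k, hU0 k⟩, fun y hy => ?_⟩
  have hyW : f y ∈ W := mixedSet_subset_of_absConvex (absConvex_preimage hW f)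
    (by simpa using mem_of_mem_nhds hW0) hUB hy
  simpa using hWO hyW

theorem mixedTopology_le (h : IsLCHausdorff 𝕜 τ') : mixedTopology 𝕜 τ τ' ≤ τ' :=
  have ⟨_, _, _, _⟩ := h
  continuous_id_iff_le.1 <|
    continuous_mixedTopology_of_continuousOn_bounded h LinearMap.id fun _ _ => continuousOn_id

theorem IsMixedBasis.continuousOn_of_continuous_mixedTopology (hB : IsMixedBasis 𝕜 τ τ' B)
    (h : IsLCHausdorff 𝕜 τ') {F : Type*} [AddCommGroup F] [Module 𝕜 F] [TopologicalSpace F]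
    [IsTopologicalAddGroup F] (f : E →ₗ[𝕜] F) (hf : Continuous[mixedTopology 𝕜 τ τ', _] f)
    {S : Set E} (hS : IsBddFor 𝕜 τ S) : ContinuousOn f S := by
  have := h.topologicalAddGroup
  obtain ⟨n, hn⟩ := hB.basis S hS
  refine fun x hx => tendsto_sub_nhds_zero_iff.1 fun V hV => mem_map.2 ?_
  have hfV : f ⁻¹' V ∈ @nhds E (mixedTopology 𝕜 τ τ') 0 :=
    (@Continuous.tendsto' E F (mixedTopology 𝕜 τ τ') _ f hf 0 0 (map_zero f)).eventually_mem hV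
  obtain ⟨U, hU, hUV⟩ := hB.exists_inter_subset_of_mem_nhds hfV (n + 1)
  have hsub : ∀ᶠ y in 𝓝[S] x, y - x ∈ U :=
    (tendsto_sub_nhds_zero_iff.2 (tendsto_id.mono_left nhdsWithin_le_nhds)).eventually_mem hU
  filter_upwards [hsub, self_mem_nhdsWithin] with y hyU hyS
  have hyB : y - x ∈ B (n + 1) := hB.double_subset n <| sub_eq_add_neg y x ▸
    add_mem_two_smul_of_absConvex (hB.absConvex n) (hn hyS)
      ((hB.absConvex n).1.neg_mem_iff.2 (hn hx))
  simpa using hUV ⟨hyU, hyB⟩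

end MixedTopology

section UnitBalls

variable {𝕜 : Type} [RCLike 𝕜] {E : Type u} [AddCommGroup E] [Module 𝕜 E] {p : Seminorm 𝕜 E}
  {τ : TopologicalSpace E}

theorem IsNormInducing.continuous_of_isVonNBounded_image (hp : IsNormInducing 𝕜 p τ) {F : Type*}
    [AddCommGroup F] [Module 𝕜 F] [TopologicalSpace F] [IsTopologicalAddGroup F] (f : E →ₗ[𝕜] F)
    (hf : IsVonNBounded 𝕜 (f '' p.closedBall 0 1)) : Continuous[τ, _] f :=
  have := hp.induces.topologicalAddGroup
  have := hp.induces.continuousSMul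
  (f.clmOfExistsBoundedImage
    ⟨_, hp.nhds_zero_hasBasis_closedBall.mem_of_mem one_pos, hf⟩).cont

variable {τ' : TopologicalSpace E}

theorem IsLCHausdorff.isClosed_closedBall (h : IsLCHausdorff 𝕜 τ')
    (hcl : IsClosed (p.closedBall 0 1)) {r : ℝ} (hr : 0 < r) : IsClosed (p.closedBall 0 r) := by
  have := h.continuousSMul
  rw [closedBall_zero_eq_smul p hr]
  exact hcl.smul_of_ne_zero (by simpa using hr.ne')

theorem IsLCHausdorff.isCompact_closedBall (h : IsLCHausdorff 𝕜 τ')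
    (hK : IsCompact (p.closedBall 0 1)) {r : ℝ} (hr : 0 < r) : IsCompact (p.closedBall 0 r) := by
  have := h.continuousSMul
  rw [closedBall_zero_eq_smul p hr]
  exact hK.smul _

theorem IsNormInducing.isMixedBasis_closedBall (hp : IsNormInducing 𝕜 p τ)
    (h : IsLCHausdorff 𝕜 τ') (hcl : IsClosed (p.closedBall 0 1)) :
    IsMixedBasis 𝕜 τ τ' fun n => p.closedBall 0 (2 ^ n) where
  nonempty n := ⟨0, by simp⟩
  absConvex n := absConvex_closedBall_zero p _
  bounded n := hp.isBddFor_closedBall _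
  closed n := h.isClosed_closedBall hcl (by positivity)
  double_subset n := by
    rw [p.smul_closedBall_zero (by simp), RCLike.norm_two, pow_succ']
  basis S hS := by
    obtain ⟨r, -, hr⟩ := hp.isBddFor_iff.1 hS
    obtain ⟨n, hn⟩ := pow_unbounded_of_one_lt r one_lt_two
    exact ⟨n, hr.trans (p.closedBall_mono hn.le)⟩

theorem IsMixedBasis.satisfiesBBCl {B : ℕ → Set E} (hB : IsMixedBasis 𝕜 τ τ' B) :
    SatisfiesBBCl 𝕜 τ τ' := fun S hS =>
  have ⟨n, hn⟩ := hB.basis S hS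
  ⟨B n, hn, hB.absConvex n, hB.bounded n, hB.closed n⟩

theorem IsNormInducing.satisfiesCNC_of_isClosed_closedBall (hp : IsNormInducing 𝕜 p τ)
    (h : IsLCHausdorff 𝕜 τ') (hcl : IsClosed (p.closedBall 0 1)) : SatisfiesCNC 𝕜 τ τ' := by
  intro V hV
  obtain ⟨r, hr, hrV⟩ := hp.nhds_zero_hasBasis_closedBall.mem_iff.1 hV
  exact ⟨_, hp.nhds_zero_hasBasis_closedBall.mem_of_mem hr, hrV, absConvex_closedBall_zero p r,
    h.isClosed_closedBall hcl hr⟩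

theorem IsNormInducing.satisfiesBBC_of_isCompact_closedBall (hp : IsNormInducing 𝕜 p τ)
    (h : IsLCHausdorff 𝕜 τ') (hK : IsCompact (p.closedBall 0 1)) : SatisfiesBBC 𝕜 τ τ' := by
  intro S hS
  obtain ⟨r, hr, hSr⟩ := hp.isBddFor_iff.1 hS
  exact ⟨_, hSr, absConvex_closedBall_zero p r, hp.isBddFor_closedBall r,
    h.isCompact_closedBall hK hr⟩

theorem IsNormInducing.le_of_isVonNBounded_closedBall (hp : IsNormInducing 𝕜 p τ)
    (h : IsLCHausdorff 𝕜 τ') (hb : IsBddFor 𝕜 τ' (p.closedBall 0 1)) : τ ≤ τ' :=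
  continuous_id_iff_le.1 <| @IsNormInducing.continuous_of_isVonNBounded_image 𝕜 _ E _ _ p τ hp E _ _
    τ' h.topologicalAddGroup LinearMap.id ((Set.image_id _).symm ▸ hb)

theorem IsNormInducing.le_of_isCompact_closedBall (hp : IsNormInducing 𝕜 p τ)
    (h : IsLCHausdorff 𝕜 τ') (hK : IsCompact (p.closedBall 0 1)) : τ ≤ τ' :=
  have := h.topologicalAddGroup
  have := h.continuousSMul
  hp.le_of_isVonNBounded_closedBall h (hK.isVonNBounded 𝕜)

theorem IsNormInducing.isBddFor_of_isBddFor_mixedTopology {τ' τ : TopologicalSpace E}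
    (hp : IsNormInducing 𝕜 p τ) (h : IsLCHausdorff 𝕜 τ') (hK : @IsCompact E τ' (p.closedBall 0 1))
    {S : Set E} (hS : IsBddFor 𝕜 (mixedTopology 𝕜 τ τ') S) : IsBddFor 𝕜 τ S := by
  obtain ⟨Y, _, _, _, e, he⟩ := hp.exists_predual h hK
  have := locallyConvexSpace_of_normedSpace (𝕜 := 𝕜) 𝕜
  let L : E →ₗ[𝕜] StrongDual 𝕜 Y := e.toLinearEquiv
  have hcont : ∀ y, Continuous[mixedTopology 𝕜 τ τ', _] fun x => L x y := fun y =>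
    continuous_mixedTopology_of_continuousOn_bounded h
      ((ContinuousLinearMap.coeLM 𝕜).flip y ∘ₗ L) (he y)
  have himage : IsVonNBounded 𝕜 (e '' S) := @isVonNBounded_image_of_continuous_apply 𝕜 _ E Y _ _
    (mixedTopology 𝕜 τ τ') _ _ _ L hcont S hS
  simpa [IsBddFor, Set.image_image] using himage.image (e.symm : StrongDual 𝕜 Y →L[𝕜] E)

theorem IsNormInducing.sameBoundedSets_mixedTopology (hp : IsNormInducing 𝕜 p τ)
    (h : IsLCHausdorff 𝕜 τ') (hK : IsCompact (p.closedBall 0 1)) :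
    SameBoundedSets 𝕜 τ (mixedTopology 𝕜 τ τ') := fun _ =>
  have := h.t2
  ⟨(hp.isMixedBasis_closedBall h hK.isClosed).isBddFor_mixedTopology
    (hp.le_of_isCompact_closedBall h hK), hp.isBddFor_of_isBddFor_mixedTopology h hK⟩

theorem IsNormInducing.isSemiReflexive_mixedTopology (hp : IsNormInducing 𝕜 p τ)
    (h : IsLCHausdorff 𝕜 τ') (hK : IsCompact (p.closedBall 0 1)) :
    IsSemiReflexive 𝕜 (mixedTopology 𝕜 τ τ') := by
  have := h.t2
  have hB := hp.isMixedBasis_closedBall h hK.isClosed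
  refine @isSemiReflexive_of_isCompact_image_eval 𝕜 _ E _ _ (mixedTopology 𝕜 τ τ') fun S hS => ?_
  obtain ⟨r, hr, hSr⟩ := hp.isBddFor_iff.1 (hp.isBddFor_of_isBddFor_mixedTopology h hK hS)
  refine ⟨_, hSr, absConvex_closedBall_zero p r, ⟨0, by simpa using hr.le⟩, ?_⟩
  refine (h.isCompact_closedBall hK hr).image_of_continuousOn (continuousOn_pi.2 fun g => ?_)
  exact hB.continuousOn_of_continuous_mixedTopology h
    (@ContinuousLinearMap.toLinearMap 𝕜 𝕜 _ _ _ E (mixedTopology 𝕜 τ τ') _ 𝕜 _ _ _ _ g)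
    (@ContinuousLinearMap.cont 𝕜 𝕜 _ _ _ E (mixedTopology 𝕜 τ τ') _ 𝕜 _ _ _ _ g)
    (hp.isBddFor_closedBall r)

end UnitBalls

section Gauge

variable {𝕜 : Type} [RCLike 𝕜] {E : Type u} [AddCommGroup E] [Module 𝕜 E] {p q : Seminorm 𝕜 E}
  {K : Set E} {r : ℝ}

theorem le_mul_of_closedBall_subset_closedBall (h : p.closedBall 0 1 ⊆ q.closedBall 0 r) (x : E) :
    q x ≤ r * p x := by
  have hlt : ∀ t > p x, q x ≤ r * t := fun t ht => by
    have ht0 : 0 < t := (apply_nonneg p x).trans_lt ht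
    have hx : x ∈ (t : 𝕜) • q.closedBall 0 r :=
      Set.smul_set_mono h (closedBall_zero_eq_smul p ht0 ▸ p.mem_closedBall_zero.2 ht.le)
    rw [q.smul_closedBall_zero (by simpa using ht0.ne'), RCLike.norm_ofReal, abs_of_pos ht0] at hx
    linarith [q.mem_closedBall_zero.1 hx]
  have hlim : Tendsto (r * ·) (𝓝[>] p x) (𝓝 (r * p x)) :=
    ((continuous_const_mul r).tendsto (p x)).mono_left nhdsWithin_le_nhds
  exact ge_of_tendsto hlim (eventually_mem_nhdsWithin.mono hlt)

theorem IsNormInducing.of_closedBall_subset {τ : TopologicalSpace E} (hp : IsNormInducing 𝕜 p τ)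
    (hpq : p.closedBall 0 1 ⊆ q.closedBall 0 1) (hqp : q.closedBall 0 1 ⊆ p.closedBall 0 r) :
    IsNormInducing 𝕜 q τ := by
  have hpr := le_mul_of_closedBall_subset_closedBall hqp
  have hr : 0 ≤ r := by simpa using hqp (show (0 : E) ∈ q.closedBall 0 1 by simp)
  refine ⟨fun x hx => hp.definite x ((apply_nonneg p x).antisymm' (by simpa [hx] using hpr x)),
    hp.induces.congr (fun _ => ⟨{0}, 1, fun x => ?_⟩) (fun _ => ⟨{0}, r.toNNReal, fun x => ?_⟩)⟩
  · simpa using le_mul_of_closedBall_subset_closedBall hpq x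
  · simpa [NNReal.smul_def, hr] using hpr x

theorem exists_seminorm_closedBall_eq [TopologicalSpace E] [ContinuousSMul 𝕜 E]
    (hK : AbsConvex 𝕜 K) (hcl : IsClosed K) (habs : Absorbent 𝕜 K) :
    ∃ q : Seminorm 𝕜 E, q.closedBall 0 1 = K := by
  let : Module ℝ E := Module.restrictScalars ℝ 𝕜 E
  have : IsScalarTower ℝ 𝕜 E := IsScalarTower.restrictScalars ℝ 𝕜 E
  have : ContinuousSMul ℝ E := IsScalarTower.continuousSMul 𝕜
  have hconv : Convex ℝ K := convex_RCLike_iff_convex_real.1 hK.2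
  have habsR : Absorbent ℝ K := fun x => (habs x).restrict_scalars <|
    (tendsto_algebraMap_cobounded ℝ 𝕜).congr fun _ => Algebra.algebraMap_eq_smul_one _
  refine ⟨gaugeSeminorm hK.1 hconv habsR, Set.ext fun x => ?_⟩
  rw [Seminorm.mem_closedBall_zero]
  exact ⟨fun hx => hcl.closure_eq ▸ mem_closure_of_gauge_le_one hconv habs.zero_mem habsR hx,
    gauge_le_one_of_mem⟩

theorem IsNormInducing.exists_closedBall_eq {τ τ' : TopologicalSpace E}
    (hp : IsNormInducing 𝕜 p τ) (h : IsLCHausdorff 𝕜 τ') (hK : AbsConvex 𝕜 K) (hcl : IsClosed K)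
    (hb : IsBddFor 𝕜 τ K) (hpK : p.closedBall 0 1 ⊆ K) :
    ∃ q : Seminorm 𝕜 E, IsNormInducing 𝕜 q τ ∧ q.closedBall 0 1 = K := by
  have := h.continuousSMul
  obtain ⟨r, -, hKr⟩ := hp.isBddFor_iff.1 hb
  obtain ⟨q, rfl⟩ := exists_seminorm_closedBall_eq hK hcl
    ((p.absorbent_closedBall_zero one_pos).mono hpK)
  exact ⟨q, hp.of_closedBall_subset hpK hKr, rfl⟩

theorem SatisfiesBBC.exists_isCompact_closedBall {τ τ' : TopologicalSpace E}
    (h : SatisfiesBBC 𝕜 τ τ') (hp : IsNormInducing 𝕜 p τ) (h' : IsLCHausdorff 𝕜 τ') :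
    ∃ q : Seminorm 𝕜 E, IsNormInducing 𝕜 q τ ∧ IsCompact (q.closedBall 0 1) := by
  have := h'.t2
  obtain ⟨K, hpK, hK, hb, hc⟩ := h _ (hp.isBddFor_closedBall 1)
  obtain ⟨q, hq, rfl⟩ := hp.exists_closedBall_eq h' hK hc.isClosed hb hpK
  exact ⟨q, hq, hc⟩

theorem SatisfiesBBCl.exists_isCompact_closedBall_of_isSemiReflexive {τ τ' : TopologicalSpace E}
    (h : SatisfiesBBCl 𝕜 τ τ') (hp : IsNormInducing 𝕜 p τ) (h' : IsLCHausdorff 𝕜 τ') (hle : τ ≤ τ')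
    (hγ : IsSemiReflexive 𝕜 (mixedTopology 𝕜 τ τ')) :
    ∃ q : Seminorm 𝕜 E, IsNormInducing 𝕜 q τ ∧
      ∃ σ : TopologicalSpace E, IsLCHausdorff 𝕜 σ ∧ @IsCompact E σ (q.closedBall 0 1) := by
  obtain ⟨K, hpK, hK, hb, hcl⟩ := h _ (hp.isBddFor_closedBall 1)
  obtain ⟨q, hq, rfl⟩ := hp.exists_closedBall_eq h' hK hcl hb hpK
  have hγb : IsBddFor 𝕜 (mixedTopology 𝕜 τ τ') (q.closedBall 0 1) :=
    (hq.isMixedBasis_closedBall h' hcl).isBddFor_mixedTopology hle hb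
  exact ⟨q, hq, exists_isLCHausdorff_isCompact_of_isSemiReflexive hγ h' (mixedTopology_le h') hK
    ⟨0, by simp⟩ hcl hγb⟩

end Gauge

section WeakDual

variable {𝕜 : Type} [RCLike 𝕜] {Z : Type u} [NormedAddCommGroup Z] [NormedSpace 𝕜 Z]

theorem isLCHausdorff_weakDual :
    IsLCHausdorff 𝕜 (inferInstance : TopologicalSpace (WeakDual 𝕜 Z)) :=
  isLCHausdorff_weakBilin (B := topDualPairing 𝕜 Z) ContinuousLinearMap.coe_injective

variable (𝕜 Z) in
/-- The evaluation map of a normed space `Z` into the strong dual of its weak-star dual. If `Z` is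
complete, it is a topological isomorphism, and the weak-star dual is then a predual of `Z`. -/
def weakDualEval : Z →ₗ[𝕜] StrongDual 𝕜 (WeakDual 𝕜 Z) :=
  WeakBilin.eval (topDualPairing 𝕜 Z)

theorem weakDualEval_injective : Function.Injective (weakDualEval 𝕜 Z) :=
  (injective_iff_map_eq_zero _).2 fun _ hx =>
    SeparatingDual.eq_zero_of_forall_dual_eq_zero (R := 𝕜) fun g =>
      DFunLike.congr_fun hx (StrongDual.toWeakDual g)

theorem weakDualEval_surjective : Function.Surjective (weakDualEval 𝕜 Z) :=
  LinearMap.dualEmbedding_surjective _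

variable [CompleteSpace Z]

theorem isSemiMontel_weakDual :
    IsSemiMontel 𝕜 (inferInstance : TopologicalSpace (WeakDual 𝕜 Z)) := fun _ hS =>
  WeakDual.isCompact_of_bounded_of_closed
    (WeakDual.isBounded_closure (WeakDual.isBounded_iff_isVonNBounded.2 hS)) isClosed_closure

theorem continuous_weakDualEval : Continuous (weakDualEval 𝕜 Z) := by
  have hbdd : IsVonNBounded 𝕜 (weakDualEval 𝕜 Z '' Metric.closedBall 0 1) := by
    refine ContinuousLinearMap.isVonNBounded_iff.2 fun S hS =>
      (NormedSpace.isVonNBounded_iff 𝕜).2 ?_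
    obtain ⟨C, hC⟩ := isBounded_iff_forall_norm_le.1 (WeakDual.isBounded_iff_isVonNBounded.2 hS)
    refine isBounded_iff_forall_norm_le.2 ⟨C, ?_⟩
    rintro _ ⟨_, ⟨x, hx, rfl⟩, φ, hφ, rfl⟩
    exact ((WeakDual.toStrongDual φ).le_of_opNorm_le_of_le (hC φ hφ)
      (mem_closedBall_zero_iff.1 hx)).trans_eq (mul_one C)
  have hnhds : ∃ V ∈ 𝓝 (0 : Z), IsVonNBounded 𝕜 (weakDualEval 𝕜 Z '' V) :=
    ⟨_, Metric.closedBall_mem_nhds 0 one_pos, hbdd⟩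
  exact (LinearMap.clmOfExistsBoundedImage (𝕜 := 𝕜) (𝕜' := 𝕜) (σ := RingHom.id 𝕜)
    (F := StrongDual 𝕜 (WeakDual 𝕜 Z)) (weakDualEval 𝕜 Z) hnhds).cont

theorem nonempty_equiv_strongDual_weakDual :
    Nonempty (Z ≃L[𝕜] StrongDual 𝕜 (WeakDual 𝕜 Z)) := by
  let e := LinearEquiv.ofBijective (weakDualEval 𝕜 Z)
    ⟨weakDualEval_injective, weakDualEval_surjective⟩
  refine ⟨⟨e, continuous_weakDualEval, ?_⟩⟩
  refine (continuous_strongDual_iff_exists_norm_le_on_polar e.symm.toLinearMap).2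
    ⟨_, (WeakDual.isCompact_closedBall 0 1).isVonNBounded 𝕜, 1, fun F hF => ?_⟩
  obtain ⟨x, rfl⟩ := e.surjective F
  obtain ⟨g, hg, hgx⟩ := exists_dual_vector'' 𝕜 x
  have hx : ‖g x‖ ≤ 1 := hF (StrongDual.toWeakDual g) (by simpa using hg)
  simpa [hgx] using hx

end WeakDual

section Preduals

variable {𝕜 : Type} [RCLike 𝕜] {E : Type u} [AddCommGroup E] [Module 𝕜 E]
  {τ : TopologicalSpace E}

theorem HasBanachPredual.hasSemiMontelPrebidual (h : HasBanachPredual 𝕜 τ) :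
    HasSemiMontelPrebidualWithCompletelyNormableDual 𝕜 τ := by
  obtain ⟨Z, _, _, _, ⟨e⟩⟩ := h.exists_normedSpace
  obtain ⟨Φ⟩ := nonempty_equiv_strongDual_weakDual (𝕜 := 𝕜) (Z := Z)
  exact ⟨WeakDual 𝕜 Z, inferInstance, inferInstance, inferInstance, isLCHausdorff_weakDual,
    isSemiMontel_weakDual, .of_equiv Φ.symm, ⟨e.trans (Φ.arrowCongr (.refl 𝕜 𝕜))⟩⟩

theorem HasSemiMontelPrebidualWithCompletelyNormableDual.hasBanachPredual
    (h : HasSemiMontelPrebidualWithCompletelyNormableDual 𝕜 τ) : HasBanachPredual 𝕜 τ := by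
  obtain ⟨Y, _, _, σ, hσ, -, hc, he⟩ := h
  have := hσ.continuousSMul
  have := locallyConvexSpace_of_normedSpace (𝕜 := 𝕜) 𝕜
  exact ⟨StrongDual 𝕜 Y, inferInstance, inferInstance, inferInstance,
    ⟨inferInstance, inferInstance, inferInstance, inferInstance⟩, hc, he⟩

theorem HasBanachPredual.exists_isCompact_closedBall (h : HasBanachPredual 𝕜 τ) :
    ∃ p : Seminorm 𝕜 E, IsNormInducing 𝕜 p τ ∧
      ∃ τ' : TopologicalSpace E, IsLCHausdorff 𝕜 τ' ∧ @IsCompact E τ' (p.closedBall 0 1) := by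
  obtain ⟨Y, _, _, -, ⟨e⟩⟩ := h.exists_normedSpace
  let B : E →ₗ[𝕜] Y →ₗ[𝕜] 𝕜 := ContinuousLinearMap.coeLM 𝕜 ∘ₗ e.toLinearMap
  have hB : Function.Injective B := ContinuousLinearMap.coe_injective.comp e.injective
  refine ⟨_, IsNormInducing.comp_equiv e, _, isLCHausdorff_weakBilin hB, ?_⟩
  let d : E ≃ₗ[𝕜] WeakDual 𝕜 Y := e.toLinearEquiv.trans StrongDual.toWeakDual
  let p : Seminorm 𝕜 E := (normSeminorm 𝕜 (StrongDual 𝕜 Y)).comp (e : E →ₗ[𝕜] StrongDual 𝕜 Y)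
  have hball : p.closedBall 0 1 = d ⁻¹' (WeakDual.toStrongDual ⁻¹' Metric.closedBall 0 1) := by
    ext x
    simp [p, d]
  have hc : IsCompact ((fun x y => B x y) '' p.closedBall 0 1) := by
    rw [show (fun x y => B x y) = DFunLike.coe ∘ d from rfl, hball, Set.image_comp,
      Set.image_preimage_eq _ d.surjective]
    exact (WeakDual.isCompact_closedBall 0 1).image WeakDual.coeFn_continuous
  exact (WeakBilin.isEmbedding hB).isCompact_iff.2 hc

theorem IsNormInducing.hasBanachPredual {p : Seminorm 𝕜 E} {τ' : TopologicalSpace E}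
    (hp : IsNormInducing 𝕜 p τ) (h : IsLCHausdorff 𝕜 τ') (hK : IsCompact (p.closedBall 0 1)) :
    HasBanachPredual 𝕜 τ :=
  have ⟨_, _, _, _, e, _⟩ := hp.exists_predual h hK
  @HasBanachPredual.of_equiv 𝕜 _ E _ _ τ _ _ _ _ e

end Preduals

theorem mainTheorem5_general {𝕜 : Type} [RCLike 𝕜] {X : Type*} [AddCommGroup X] [Module 𝕜 X]
    (τ : TopologicalSpace X) :
    List.TFAE [
      HasBanachPredual 𝕜 τ,
      HasSemiMontelPrebidualWithCompletelyNormableDual 𝕜 τ,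
      IsCompletelyNormable 𝕜 τ ∧
        ∃ τ' : TopologicalSpace X, IsLCHausdorff 𝕜 τ' ∧
          SatisfiesBBC 𝕜 τ τ' ∧ SatisfiesCNC 𝕜 τ τ' ∧
          SameBoundedSets 𝕜 τ (mixedTopology 𝕜 τ τ'),
      IsCompletelyNormable 𝕜 τ ∧
        ∃ τ' : TopologicalSpace X, IsLCHausdorff 𝕜 τ' ∧ τ ≤ τ' ∧
          SatisfiesBBCl 𝕜 τ τ' ∧ IsSemiReflexive 𝕜 (mixedTopology 𝕜 τ τ'),
      IsCompletelyNormable 𝕜 τ ∧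
        ∃ τ' : TopologicalSpace X, IsLCHausdorff 𝕜 τ' ∧ SatisfiesBBC 𝕜 τ τ',
      ∃ p : Seminorm 𝕜 X, IsNormInducing 𝕜 p τ ∧
        ∃ τ' : TopologicalSpace X, IsLCHausdorff 𝕜 τ' ∧
          @IsCompact X τ' (p.closedBall 0 1)] := by
  tfae_have 1 → 2 := HasBanachPredual.hasSemiMontelPrebidual
  tfae_have 2 → 1 := HasSemiMontelPrebidualWithCompletelyNormableDual.hasBanachPredual
  tfae_have 1 → 6 := HasBanachPredual.exists_isCompact_closedBall
  tfae_have 6 → 1 := fun ⟨_, hp, _, h, hK⟩ => hp.hasBanachPredual h hK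
  tfae_have 6 → 3 := fun ⟨_, hp, τ', h, hK⟩ =>
    have := h.t2
    ⟨(hp.hasBanachPredual h hK).isCompletelyNormable, τ', h,
      hp.satisfiesBBC_of_isCompact_closedBall h hK,
      hp.satisfiesCNC_of_isClosed_closedBall h hK.isClosed,
      hp.sameBoundedSets_mixedTopology h hK⟩
  tfae_have 6 → 4 := fun ⟨_, hp, τ', h, hK⟩ =>
    have := h.t2
    ⟨(hp.hasBanachPredual h hK).isCompletelyNormable, τ', h, hp.le_of_isCompact_closedBall h hK,
      (hp.isMixedBasis_closedBall h hK.isClosed).satisfiesBBCl,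
      hp.isSemiReflexive_mixedTopology h hK⟩
  tfae_have 3 → 5 := fun ⟨hc, τ', h, hB, _⟩ => ⟨hc, τ', h, hB⟩
  tfae_have 5 → 6 := fun ⟨⟨_, hp, _⟩, τ', h, hB⟩ =>
    have ⟨q, hq, hK⟩ := hB.exists_isCompact_closedBall hp h
    ⟨q, hq, τ', h, hK⟩
  tfae_have 4 → 6 := fun ⟨⟨_, hp, _⟩, _, h, hle, hB, hγ⟩ =>
    hB.exists_isCompact_closedBall_of_isSemiReflexive hp h hle hγ
  tfae_finish

-- In Mathlib's order on topologies, `τ ≤ τ'` says that `τ'` is coarser than `τ`.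
theorem mainTheorem5 {𝕜 : Type} [RCLike 𝕜] {X : Type*} [AddCommGroup X] [Module 𝕜 X]
    (τ : TopologicalSpace X) (hτ : IsLCHausdorff 𝕜 τ) (hborn : IsBornological 𝕜 τ) :
    List.TFAE [
      HasBanachPredual 𝕜 τ,
      HasSemiMontelPrebidualWithCompletelyNormableDual 𝕜 τ,
      IsCompletelyNormable 𝕜 τ ∧
        ∃ τ' : TopologicalSpace X, IsLCHausdorff 𝕜 τ' ∧
          SatisfiesBBC 𝕜 τ τ' ∧ SatisfiesCNC 𝕜 τ τ' ∧
          SameBoundedSets 𝕜 τ (mixedTopology 𝕜 τ τ'),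
      IsCompletelyNormable 𝕜 τ ∧
        ∃ τ' : TopologicalSpace X, IsLCHausdorff 𝕜 τ' ∧ τ ≤ τ' ∧
          SatisfiesBBCl 𝕜 τ τ' ∧ IsSemiReflexive 𝕜 (mixedTopology 𝕜 τ τ'),
      IsCompletelyNormable 𝕜 τ ∧
        ∃ τ' : TopologicalSpace X, IsLCHausdorff 𝕜 τ' ∧ SatisfiesBBC 𝕜 τ τ',
      ∃ p : Seminorm 𝕜 X, IsNormInducing 𝕜 p τ ∧
        ∃ τ' : TopologicalSpace X, IsLCHausdorff 𝕜 τ' ∧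
          @IsCompact X τ' (p.closedBall 0 1)] :=
  mainTheorem5_general τ
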